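/- Let $(X_i)_{i\ge 1}$ be i.i.d. complex random variables on a probability space, let $\mu$ be the law of $W=X_2-X_1$, and assume that $\mathbb E|W|<\infty$ (so that $\mu$ is centred, $\mathbb E W=0$) and $\mu\neq\delta_0$. For complex $z$ let $\arg z\in[0,2\pi)$, with $\arg 0=0$. For $n\ge 1$ let $W_i=W_i^{(n)}=X_{(i \bmod n)+1}-X_i$, $1\le i\le n$ (so $\sum_i W_i=0$); let $\hat W_1,\dots,\hat W_n$ be the $W_i$ sorted by increasing argument (vectors with equal arguments being put in an arbitrary, possibly random, order); let $S(k)=\sum_{j=1}^k\hat W_j$ for $0\le k\le n$, interpolated linearly between consecutive integers; let $\mathbf B_n=\{S(t):t\in[0,n]\}$; and for $\theta\in[0,2\pi)$ let $N_n(\theta)=\#\{i:\arg W_i\le\theta\}$. Let $\nu=\mathsf K(\mu)$ be the measure on $[0,2\pi)$ given by $d\nu(x)=\frac{m_x}{\mathbb E|W|}\,d\mathbb P_{\arg W}(x)$, where $\mathbb P_{\arg W}$ is the law of $\arg W$ and $m_x$ is the mean of $|W|$ under the conditional law of $|W|$ given $\arg W=x$. Let $F_\nu(x)=\nu([0,x])$,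 $F_\nu^{-1}(y)=\inf\{x\ge 0: F_\nu(x)\ge y\}$, $Z_\nu(t)=\int_0^t e^{iF_\nu^{-1}(u)}\,du$ for $t\in[0,1]$, and $\mathcal B_\nu=\{Z_\nu(t):t\in[0,1]\}$. Then: 1. almost surely, $d_H\big(\mathbf B_n/(n\,\mathbb E|W|),\ \mathcal B_\nu\big)\to 0$ as $n\to\infty$, where $d_H$ is the Hausdorff distance; 2. for every $\theta\in[0,2\pi)$, almost surely, $$\frac{S(N_n(\theta))}{n\,\mathbb E|W|}\ \longrightarrow\ \int_{[0,\theta]}e^{it}\,d\nu(t)=Z_\nu(F_\nu(\theta))\qquad(n\to\infty).$$ -/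

import Mathlib

open MeasureTheory ProbabilityTheory Filter Topology

noncomputable section

namespace ReorderedPolygon

/-! ### Measures on `[0, 2π)` and the curves attached to them -/

/-- The cumulative distribution function `F_ν(x) = ν([0, x])` of a measure on `[0, 2π)`. -/
def cdf (ν : Measure ℝ) (x : ℝ) : ℝ := ν.real (Set.Icc 0 x)

/-- The standard generalised inverse `F_ν⁻¹(y) = inf {x ≥ 0 : F_ν(x) ≥ y}`. -/
def quantile (ν : Measure ℝ) (y : ℝ) : ℝ := sInf {x : ℝ | 0 ≤ x ∧ y ≤ cdf ν x}

/-- The parametrised curve `Z_ν(t) = ∫₀ᵗ exp(i F_ν⁻¹(u)) du`, `t ∈ [0, 1]`. -/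
def curve (ν : Measure ℝ) (t : ℝ) : ℂ :=
  ∫ u in (0 : ℝ)..t, Complex.exp (Complex.I * (quantile ν u : ℂ))

/-- The curve `B_ν = {Z_ν(t) : t ∈ [0, 1]}` as a subset of the plane. -/
def curveSet (ν : Measure ℝ) : Set ℂ := curve ν '' Set.Icc 0 1

/-! ### From distributions on the plane to measures on `[0, 2π)` -/

/-- The argument of a complex number, taken in `[0, 2π)` (and equal to `0` at `0`). -/
def arg (z : ℂ) : ℝ :=
  if 0 ≤ Complex.arg z then Complex.arg z else Complex.arg z + 2 * Real.pi

/-- The mean modulus `E|W|` of a random variable `W` with law `μ`. -/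
def meanNorm (μ : Measure ℂ) : ℝ := ∫ z, ‖z‖ ∂μ

/-- `m_x`: the mean of `|W|` under the conditional law of `|W|` given `arg W = x`, where `W` has
law `μ`. -/
def condMeanNorm (μ : Measure ℂ) [IsFiniteMeasure μ] (x : ℝ) : ℝ :=
  ∫ r, r ∂(condDistrib (fun z : ℂ => ‖z‖) arg μ x)

/-- The measure `K(μ)`, which has density `x ↦ m_x / E|W|` with respect to the law of `arg W`,
where `W` has law `μ`. -/
def K (μ : Measure ℂ) [IsFiniteMeasure μ] : Measure ℝ :=
  (μ.map arg).withDensity fun x => ENNReal.ofReal (condMeanNorm μ x / meanNorm μ)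

/-! ### Sorted polygonal lines -/

/-- The permutation `σ` sorts the vectors `w₀, …, w_{n-1}` according to their arguments
(vectors with the same argument may come in any order). -/
def SortsByArg {n : ℕ} (w : Fin n → ℂ) (σ : Equiv.Perm (Fin n)) : Prop :=
  Monotone fun j => arg (w (σ j))

/-- `S(k)`: the sum of the first `k` vectors of the list `v₀, …, v_{n-1}`. -/
def partialSum {n : ℕ} (v : Fin n → ℂ) (k : ℕ) : ℂ :=
  ∑ j : Fin n with j.val < k, v j

/-- `S(t)`, `t ∈ [0, n]`: the piecewise linear interpolation of the partial sums. -/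
def interpolatedSum {n : ℕ} (v : Fin n → ℂ) (t : ℝ) : ℂ :=
  partialSum v ⌊t⌋₊ +
    ((t - ⌊t⌋₊ : ℝ) : ℂ) * (partialSum v (⌊t⌋₊ + 1) - partialSum v ⌊t⌋₊)

/-- The polygonal line `{S(t) : t ∈ [0, n]}` whose successive sides are `v₀, …, v_{n-1}`. -/
def polygonalLine {n : ℕ} (v : Fin n → ℂ) : Set ℂ :=
  interpolatedSum v '' Set.Icc 0 (n : ℝ)

/-- `N_n(θ)`: the number of vectors among `w₀, …, w_{n-1}` with argument at most `θ`. -/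
def countArgLE {n : ℕ} (w : Fin n → ℂ) (θ : ℝ) : ℕ :=
  Nat.card {i : Fin n // arg (w i) ≤ θ}

/-- The cyclic increments `W_i = x_{i+1 mod n} - x_i`, `0 ≤ i < n`. -/
def cyclicIncrement (x : ℕ → ℂ) (n : ℕ) (i : Fin n) : ℂ :=
  x ((i.val + 1) % n) - x i.val

end ReorderedPolygon

end

namespace ReorderedPolygon

/-! ### A law of large numbers for consecutive differences -/

/-! Parametrised by arc length, a polygonal line with sides sorted by argument is its total length
times a unit-speed curve, whose direction is the generalised inverse of the proportion of length
carried by arguments at most `x` (`polygonalLine_eq_image_curveOf`). `K μ` is the limiting version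
of this proportion: it is the image under `arg` of `μ` reweighted by `‖z‖ / E|W|` (`K_eq_map`).

Everything then reduces to laws of large numbers for sums of `f (W_i)` with `‖f z‖ ≤ ‖z‖`
(`ae_tendsto_mean_cyclicIncrement`). They give convergence of the normalised length and of the
length proportions at every rational. Generalised inverses then converge almost everywhere, so the
unit tangents converge in L¹ (`tendsto_integral_norm_sub`); hence the curves converge uniformly and
their images in Hausdorff distance.

For the second claim, `S(N_n(θ))` is the sum of the `W_i` with argument at most `θ`, whatever the
order of ties, so the law of large numbers applies directly. The two forms of the limit agree
because the quantile function pushes Lebesgue measure on `(0, 1]` to `ν` (`map_quantile`). -/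

theorem sum_range_eq_even_add_odd {E : Type*} [AddCommMonoid E] (a : ℕ → E) (n : ℕ) :
    ∑ i ∈ Finset.range n, a i =
      ∑ i ∈ Finset.range ((n + 1) / 2), a (2 * i) + ∑ i ∈ Finset.range (n / 2), a (2 * i + 1) := by
  induction n with
  | zero => simp
  | succ n ih =>
    rw [Finset.sum_range_succ, ih]
    rcases Nat.even_or_odd' n with ⟨k, rfl | rfl⟩
    · rw [show (2 * k + 1) / 2 = k by omega, show 2 * k / 2 = k by omega,
        show (2 * k + 1 + 1) / 2 = k + 1 by omega, Finset.sum_range_succ]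
      abel
    · rw [show (2 * k + 1 + 1) / 2 = k + 1 by omega, show (2 * k + 1) / 2 = k by omega,
        show (2 * k + 1 + 1 + 1) / 2 = k + 1 by omega, Finset.sum_range_succ _ k,
        Finset.sum_range_succ _ k]
      abel

theorem tendsto_div_two_div (j : ℕ) :
    Tendsto (fun n : ℕ => (((n + j) / 2 : ℕ) : ℝ) / n) atTop (𝓝 (1 / 2)) := by
  have h1 : Tendsto (fun n : ℕ => ((j : ℝ) + 1) / n) atTop (𝓝 0) :=
    tendsto_const_div_atTop_nhds_zero_nat _
  rw [tendsto_iff_norm_sub_tendsto_zero]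
  refine squeeze_zero' (Eventually.of_forall fun _ => norm_nonneg _) ?_ h1
  filter_upwards [eventually_gt_atTop 0] with n hn
  have hn' : (0 : ℝ) < n := by exact_mod_cast hn
  have e : (((n + j) / 2 : ℕ) : ℝ) / n - 1 / 2 = ((((n + j) / 2 : ℕ) : ℝ) - n / 2) / n := by
    field_simp
  rw [e, norm_div, Real.norm_natCast]
  gcongr
  have h2 : 2 * ((n + j) / 2) ≤ n + j := by omega
  have h3 : n + j ≤ 2 * ((n + j) / 2) + 1 := by omega
  have h2' : 2 * (((n + j) / 2 : ℕ) : ℝ) ≤ n + j := by exact_mod_cast h2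
  have h3' : (n + j : ℝ) ≤ 2 * (((n + j) / 2 : ℕ) : ℝ) + 1 := by exact_mod_cast h3
  have : (0 : ℝ) ≤ j := j.cast_nonneg
  rw [Real.norm_eq_abs, abs_le]
  constructor <;> linarith

theorem tendsto_mean_of_even_odd {E : Type*} [NormedAddCommGroup E] [NormedSpace ℝ E]
    {a : ℕ → E} {c : E}
    (h0 : Tendsto (fun n : ℕ => (n : ℝ)⁻¹ • ∑ i ∈ Finset.range n, a (2 * i)) atTop (𝓝 c))
    (h1 : Tendsto (fun n : ℕ => (n : ℝ)⁻¹ • ∑ i ∈ Finset.range n, a (2 * i + 1)) atTop (𝓝 c)) :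
    Tendsto (fun n : ℕ => (n : ℝ)⁻¹ • ∑ i ∈ Finset.range n, a i) atTop (𝓝 c) := by
  have hd (j : ℕ) : Tendsto (fun n : ℕ => (n + j) / 2) atTop atTop :=
    tendsto_atTop_atTop.2 fun b => ⟨2 * b, fun n hn => by omega⟩
  have key := ((tendsto_div_two_div 1).smul (h0.comp (hd 1))).add
    ((tendsto_div_two_div 0).smul (h1.comp (hd 0)))
  rw [← add_smul, show (1 / 2 + 1 / 2 : ℝ) = 1 by norm_num, one_smul] at key
  have aux (m n : ℕ) (b : ℕ → E) : ((m : ℝ) / n) • ((m : ℝ)⁻¹ • ∑ i ∈ Finset.range m, b i) =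
      (n : ℝ)⁻¹ • ∑ i ∈ Finset.range m, b i := by
    rcases Nat.eq_zero_or_pos m with rfl | hm
    · simp
    · have : (m : ℝ) ≠ 0 := by positivity
      rw [smul_smul]
      congr 1
      field_simp
  refine key.congr fun n => ?_
  simp only [Function.comp_apply, aux, add_zero]
  rw [← smul_add, ← sum_range_eq_even_add_odd]

section LLN

variable {Ω : Type*} [MeasurableSpace Ω] {P : Measure Ω} [IsProbabilityMeasure P]
  {X : ℕ → Ω → ℂ}

theorem identDistrib_sub (hX_indep : iIndepFun X P)
    (hX_ident : ∀ i, IdentDistrib (X i) (X 0) P P) {i j k l : ℕ} (hij : i ≠ j) (hkl : k ≠ l) :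
    IdentDistrib (fun ω => X i ω - X j ω) (fun ω => X k ω - X l ω) P P := by
  have h := IdentDistrib.prodMk ((hX_ident i).trans (hX_ident k).symm)
    ((hX_ident j).trans (hX_ident l).symm) (hX_indep.indepFun hij) (hX_indep.indepFun hkl)
  exact h.comp (u := fun p : ℂ × ℂ => p.1 - p.2) (by fun_prop)

/-- Consecutive differences are dependent, but those of even index use disjoint pairs of the `X i`,
and so do those of odd index. The strong law, for which pairwise independence suffices, applies to
each class. -/
theorem ae_tendsto_mean_consecutive {E : Type*} [NormedAddCommGroup E] [NormedSpace ℝ E]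
    [CompleteSpace E] [MeasurableSpace E] [BorelSpace E]
    (hX_meas : ∀ i, Measurable (X i)) (hX_indep : iIndepFun X P)
    (hX_ident : ∀ i, IdentDistrib (X i) (X 0) P P) {f : ℂ → E} (hf : Measurable f)
    (hint : Integrable f (P.map fun ω => X 1 ω - X 0 ω)) :
    ∀ᵐ ω ∂P, Tendsto (fun n : ℕ => (n : ℝ)⁻¹ • ∑ i ∈ Finset.range n, f (X (i + 1) ω - X i ω))
      atTop (𝓝 (∫ z, f z ∂(P.map fun ω => X 1 ω - X 0 ω))) := by
  have hm : AEMeasurable (fun ω => X 1 ω - X 0 ω) P := ((hX_meas 1).sub (hX_meas 0)).aemeasurable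
  have hint1 : Integrable (fun ω => f (X 1 ω - X 0 ω)) P := hint.comp_aemeasurable hm
  have hid (j i : ℕ) : IdentDistrib (fun ω => f (X (2 * i + j + 1) ω - X (2 * i + j) ω))
      (fun ω => f (X 1 ω - X 0 ω)) P P :=
    (identDistrib_sub hX_indep hX_ident (by omega) (by omega)).comp hf
  have main (j : ℕ) := strong_law_ae (fun i ω => f (X (2 * i + j + 1) ω - X (2 * i + j) ω))
    ((hid j 0).integrable_iff.2 hint1)
    (fun a b hab => by
      have := hX_indep.indepFun_prodMk_prodMk hX_meas (2 * a + j + 1) (2 * a + j) (2 * b + j + 1)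
        (2 * b + j) (by omega) (by omega) (by omega) (by omega)
      have hg : Measurable fun p : ℂ × ℂ => f (p.1 - p.2) := hf.comp (by fun_prop)
      exact this.comp hg hg)
    (fun i => (hid j i).trans (hid j 0).symm)
  have hlim (j : ℕ) : (∫ ω, f (X (2 * 0 + j + 1) ω - X (2 * 0 + j) ω) ∂P) =
      ∫ z, f z ∂(P.map fun ω => X 1 ω - X 0 ω) := by
    rw [(hid j 0).integral_eq, integral_map hm hint.1]
  filter_upwards [main 0, main 1] with ω h0 h1
  rw [hlim 0] at h0
  rw [hlim 1] at h1
  exact tendsto_mean_of_even_odd h0 h1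

/-- Swapping the two variables shows that the law is symmetric, so its mean is its own opposite. -/
theorem integral_id_law_sub (hX_meas : ∀ i, Measurable (X i)) (hX_indep : iIndepFun X P)
    (hX_ident : ∀ i, IdentDistrib (X i) (X 0) P P) :
    ∫ z, z ∂(P.map fun ω => X 1 ω - X 0 ω) = 0 := by
  have hm : AEMeasurable (fun ω => X 1 ω - X 0 ω) P := ((hX_meas 1).sub (hX_meas 0)).aemeasurable
  rw [integral_map hm (by fun_prop)]
  have h := (identDistrib_sub hX_indep hX_ident (i := 1) (j := 0) (k := 0) (l := 1)
    (by omega) (by omega)).integral_eq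
  have h2 : ∫ ω, (X 0 ω - X 1 ω) ∂P = -∫ ω, (X 1 ω - X 0 ω) ∂P := by
    rw [← integral_neg]
    simp
  rw [h2] at h
  exact self_eq_neg.1 h

/-! ### Adding the increment that closes the cycle. -/

theorem sum_cyclicIncrement {E : Type*} [AddCommMonoid E] (x : ℕ → ℂ) (f : ℂ → E) (n : ℕ) :
    ∑ i, f (cyclicIncrement x (n + 1) i) =
      ∑ i ∈ Finset.range n, f (x (i + 1) - x i) + f (x 0 - x n) := by
  rw [Fin.sum_univ_castSucc, Finset.sum_range]
  congr 1
  · refine Finset.sum_congr rfl fun i _ => ?_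
    simp only [cyclicIncrement, Fin.val_castSucc]
    rw [Nat.mod_eq_of_lt (by omega)]
  · simp [cyclicIncrement]

theorem ae_tendsto_mean_cyclicIncrement {E : Type*} [NormedAddCommGroup E] [NormedSpace ℝ E]
    [CompleteSpace E] [MeasurableSpace E] [BorelSpace E]
    (hX_meas : ∀ i, Measurable (X i)) (hX_indep : iIndepFun X P)
    (hX_ident : ∀ i, IdentDistrib (X i) (X 0) P P)
    (hint : Integrable (fun z => z) (P.map fun ω => X 1 ω - X 0 ω))
    {f : ℂ → E} (hf : StronglyMeasurable f) (hf_le : ∀ z, ‖f z‖ ≤ ‖z‖) :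
    ∀ᵐ ω ∂P, Tendsto
      (fun n : ℕ => (n : ℝ)⁻¹ • ∑ i, f (cyclicIncrement (fun i => X i ω) n i))
      atTop (𝓝 (∫ z, f z ∂(P.map fun ω => X 1 ω - X 0 ω))) := by
  have hintf : Integrable f (P.map fun ω => X 1 ω - X 0 ω) :=
    hint.mono hf.aestronglyMeasurable (Eventually.of_forall hf_le)
  filter_upwards [ae_tendsto_mean_consecutive hX_meas hX_indep hX_ident hf.measurable hintf,
    ae_tendsto_mean_consecutive hX_meas hX_indep hX_ident measurable_id hint] with ω h1 h2
  -- For `f = id` the sum telescopes, so `(X n - X 0) / n` tends to the mean `0`; the bound on `f`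
  -- makes the closing term negligible.
  simp only [id, Finset.sum_range_sub (fun i => X i ω)] at h2
  rw [integral_id_law_sub hX_meas hX_indep hX_ident] at h2
  have h3 : Tendsto (fun n : ℕ => (n : ℝ)⁻¹ • f (X 0 ω - X n ω)) atTop (𝓝 0) := by
    refine squeeze_zero_norm (fun n => ?_) (tendsto_zero_iff_norm_tendsto_zero.1 h2)
    rw [norm_smul, norm_smul, ← norm_sub_rev (X 0 ω)]
    gcongr
    exact hf_le _
  have h4 := (tendsto_natCast_div_add_atTop (1 : ℝ)).smul (h1.add h3)
  rw [one_smul, add_zero] at h4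
  rw [← tendsto_add_atTop_iff_nat 1]
  refine h4.congr' ?_
  filter_upwards [eventually_gt_atTop 0] with n hn
  have hn' : (n : ℝ) ≠ 0 := by positivity
  rw [sum_cyclicIncrement (fun i => X i ω), ← smul_add, smul_smul]
  congr 1
  push_cast
  field_simp

end LLN

end ReorderedPolygon

namespace ReorderedPolygon

/-! ### The argument and the measure `K μ` -/

theorem measurable_arg : Measurable arg :=
  Measurable.ite (measurableSet_le measurable_const Complex.measurable_arg)
    Complex.measurable_arg (Complex.measurable_arg.add_const _)

theorem arg_mem_Ico (z : ℂ) : arg z ∈ Set.Ico 0 (2 * Real.pi) := by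
  have h1 := Complex.neg_pi_lt_arg z
  have h2 := Complex.arg_le_pi z
  have h3 := Real.pi_pos
  unfold arg
  split_ifs with h
  · exact ⟨h, by linarith⟩
  · push Not at h
    exact ⟨by linarith, by linarith⟩

theorem norm_mul_exp_arg (z : ℂ) : (‖z‖ : ℂ) * Complex.exp (Complex.I * (arg z : ℂ)) = z := by
  conv_rhs => rw [← Complex.norm_mul_exp_arg_mul_I z]
  congr 1
  unfold arg
  split_ifs with h
  · rw [mul_comm]
  · push_cast
    rw [mul_add, Complex.exp_add, mul_comm Complex.I (2 * _ : ℂ), Complex.exp_two_pi_mul_I, mul_one,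
      mul_comm]

variable (μ : Measure ℂ)

theorem meanNorm_pos (hμ_int : Integrable (fun z : ℂ => z) μ) [IsProbabilityMeasure μ]
    (hμ_ne : μ ≠ Measure.dirac 0) :
    0 < meanNorm μ := by
  refine lt_of_le_of_ne (integral_nonneg fun _ => norm_nonneg _) fun h => hμ_ne ?_
  have h0 := (integral_eq_zero_iff_of_nonneg (fun _ => norm_nonneg _) hμ_int.norm).1 h.symm
  have h1 : (fun z : ℂ => z) =ᵐ[μ] fun _ => 0 := h0.mono fun z hz => norm_eq_zero.1 hz
  have := Measure.map_congr (mβ := inferInstanceAs (MeasurableSpace ℂ)) h1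
  rw [Measure.map_const, measure_univ, one_smul] at this
  rwa [show (fun z : ℂ => z) = id from rfl, Measure.map_id] at this

/-- Disintegrating the joint law of `(arg z, ‖z‖)` over its first coordinate turns the conditional
mean into an integral of `‖z‖` against `μ`, which removes `condDistrib`. -/
theorem K_eq_map [IsProbabilityMeasure μ] (hμ_int : Integrable (fun z : ℂ => z) μ)  :
    K μ = (μ.withDensity fun z => ENNReal.ofReal (‖z‖ / meanNorm μ)).map arg := by
  have hE : 0 ≤ meanNorm μ := integral_nonneg fun _ => norm_nonneg _
  set κ := condDistrib (fun z : ℂ => ‖z‖) arg μ with hκ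
  have hcomp : (μ.map arg) ⊗ₘ κ = μ.map fun z => (arg z, ‖z‖) :=
    compProd_map_condDistrib measurable_norm.aemeasurable
  have hmeas : Measurable fun z : ℂ => (arg z, ‖z‖) := measurable_arg.prodMk measurable_norm
  have hprob : IsProbabilityMeasure (μ.map arg) :=
    Measure.isProbabilityMeasure_map measurable_arg.aemeasurable
  have hnn : ∀ᵐ x ∂(μ.map arg), ∀ᵐ r ∂(κ x), 0 ≤ r := by
    refine Measure.ae_ae_of_ae_compProd (p := fun q : ℝ × ℝ => 0 ≤ q.2) ?_
    rw [hcomp, ae_map_iff hmeas.aemeasurable (measurableSet_le measurable_const measurable_snd)]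
    exact Eventually.of_forall fun z => norm_nonneg z
  have hI : ∀ᵐ x ∂(μ.map arg), Integrable (fun r => r) (κ x) := by
    have : Integrable (fun q : ℝ × ℝ => q.2) ((μ.map arg) ⊗ₘ κ) := by
      rw [hcomp, integrable_map_measure (by fun_prop) hmeas.aemeasurable]
      exact hμ_int.norm
    exact ((Measure.integrable_compProd_iff this.1).1 this).1
  ext s hs
  rw [K, withDensity_apply _ hs, Measure.map_apply measurable_arg hs,
    withDensity_apply _ (measurable_arg hs)]
  have e1 : ∫⁻ x in s, ENNReal.ofReal (condMeanNorm μ x / meanNorm μ) ∂(μ.map arg) =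
      ∫⁻ x in s, ∫⁻ r, ENNReal.ofReal (r / meanNorm μ) ∂(κ x) ∂(μ.map arg) := by
    refine lintegral_congr_ae (ae_restrict_of_ae ?_)
    filter_upwards [hnn, hI] with x h1 h2
    rw [← ofReal_integral_eq_lintegral_ofReal (h2.div_const _)
      (h1.mono fun r hr => div_nonneg hr hE), integral_div]
    rfl
  rw [e1]
  have e2 := Measure.setLIntegral_compProd (μ := μ.map arg) (κ := κ)
    (f := fun q : ℝ × ℝ => ENNReal.ofReal (q.2 / meanNorm μ)) (by fun_prop) hs MeasurableSet.univ
  simp only [Measure.restrict_univ] at e2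
  rw [← e2, hcomp, setLIntegral_map (hs.prod MeasurableSet.univ) (by fun_prop) hmeas]
  congr 2
  ext z
  simp

variable {μ}

theorem isProbabilityMeasure_K [IsProbabilityMeasure μ] (hμ_int : Integrable (fun z : ℂ => z) μ)
    (hE : 0 < meanNorm μ) : IsProbabilityMeasure (K μ) := by
  constructor
  rw [K_eq_map μ hμ_int, Measure.map_apply measurable_arg MeasurableSet.univ, Set.preimage_univ,
    withDensity_apply _ MeasurableSet.univ, Measure.restrict_univ,
    ← ofReal_integral_eq_lintegral_ofReal (hμ_int.norm.div_const _)
      (Eventually.of_forall fun z => div_nonneg (norm_nonneg _) hE.le), integral_div]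
  change ENNReal.ofReal (meanNorm μ / meanNorm μ) = 1
  rw [div_self hE.ne', ENNReal.ofReal_one]

theorem K_compl_Ico [IsProbabilityMeasure μ] (hμ_int : Integrable (fun z : ℂ => z) μ) :
    K μ (Set.Ico 0 (2 * Real.pi))ᶜ = 0 := by
  rw [K_eq_map μ hμ_int, Measure.map_apply measurable_arg measurableSet_Ico.compl,
    Set.preimage_eq_empty, measure_empty]
  rw [Set.disjoint_left]
  rintro _ h ⟨z, rfl⟩
  exact h (arg_mem_Ico z)

theorem arg_preimage_Icc (θ : ℝ) : arg ⁻¹' Set.Icc 0 θ = {z | arg z ≤ θ} := by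
  ext z
  simp [(arg_mem_Ico z).1]

theorem measurableSet_arg_le (θ : ℝ) : MeasurableSet {z : ℂ | arg z ≤ θ} :=
  measurableSet_le measurable_arg measurable_const

theorem cdf_K [IsProbabilityMeasure μ] (hμ_int : Integrable (fun z : ℂ => z) μ)
    (hE : 0 < meanNorm μ) (θ : ℝ) :
    cdf (K μ) θ = (∫ z, {z : ℂ | arg z ≤ θ}.indicator (fun z => ‖z‖) z ∂μ) / meanNorm μ := by
  rw [cdf, measureReal_def, K_eq_map μ hμ_int, Measure.map_apply measurable_arg measurableSet_Icc,
    arg_preimage_Icc, withDensity_apply _ (measurableSet_arg_le θ),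
    ← ofReal_integral_eq_lintegral_ofReal (hμ_int.norm.div_const _).restrict
      (Eventually.of_forall fun z => div_nonneg (norm_nonneg _) hE.le), integral_div,
    ENNReal.toReal_ofReal (div_nonneg (integral_nonneg fun _ => norm_nonneg _) hE.le),
    integral_indicator (measurableSet_arg_le θ)]

theorem setIntegral_exp_K [IsProbabilityMeasure μ] (hμ_int : Integrable (fun z : ℂ => z) μ)
    (hE : 0 < meanNorm μ) (θ : ℝ) :
    ∫ t in Set.Icc 0 θ, Complex.exp (Complex.I * (t : ℂ)) ∂(K μ) =
      (∫ z, {z : ℂ | arg z ≤ θ}.indicator (fun z => z) z ∂μ) / meanNorm μ := by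
  rw [K_eq_map μ hμ_int, setIntegral_map measurableSet_Icc (by fun_prop)
    measurable_arg.aemeasurable, arg_preimage_Icc,
    setIntegral_withDensity_eq_setIntegral_toReal_smul (by fun_prop)
      (Eventually.of_forall fun _ => ENNReal.ofReal_lt_top) _ (measurableSet_arg_le θ),
    integral_indicator (measurableSet_arg_le θ), ← integral_div]
  refine integral_congr_ae (Eventually.of_forall fun z => ?_)
  simp only
  rw [ENNReal.toReal_ofReal (div_nonneg (norm_nonneg _) hE.le), Complex.real_smul]
  push_cast
  rw [div_mul_eq_mul_div, norm_mul_exp_arg]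

end ReorderedPolygon

noncomputable section

namespace ReorderedPolygon

/-! ### Generalised inverses and unit-speed curves -/

/-- The generalised inverse of a function on `[0, ∞)`. -/
def genInv (F : ℝ → ℝ) (y : ℝ) : ℝ := sInf {x : ℝ | 0 ≤ x ∧ y ≤ F x}

/-- The curve with unit speed and direction `genInv F`. -/
def curveOf (F : ℝ → ℝ) (t : ℝ) : ℂ :=
  ∫ u in (0 : ℝ)..t, Complex.exp (Complex.I * (genInv F u : ℂ))

/-- `F` is nondecreasing and reaches the level `1` on `[0, ∞)`. -/
structure IsCdfLike (F : ℝ → ℝ) : Prop where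
  mono : Monotone F
  exists_one_le : ∃ x, 0 ≤ x ∧ 1 ≤ F x

theorem genInv_nonneg (F : ℝ → ℝ) (y : ℝ) : 0 ≤ genInv F y := Real.sInf_nonneg fun _ hx => hx.1

theorem bddBelow_genInv (F : ℝ → ℝ) (y : ℝ) : BddBelow {x : ℝ | 0 ≤ x ∧ y ≤ F x} :=
  ⟨0, fun _ hx => hx.1⟩

theorem genInv_le {F : ℝ → ℝ} {x y : ℝ} (hx : 0 ≤ x) (h : y ≤ F x) : genInv F y ≤ x :=
  csInf_le (bddBelow_genInv F y) ⟨hx, h⟩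

/-- Above level `1` the set may be empty and `sInf` would give `0`; hence the restriction to levels
at most `1` in what follows. -/
theorem IsCdfLike.nonempty {F : ℝ → ℝ} (hF : IsCdfLike F) {y : ℝ} (hy : y ≤ 1) :
    {x : ℝ | 0 ≤ x ∧ y ≤ F x}.Nonempty :=
  let ⟨x, hx, h⟩ := hF.exists_one_le
  ⟨x, hx, hy.trans h⟩

theorem IsCdfLike.le_genInv {F : ℝ → ℝ} (hF : IsCdfLike F) {x y : ℝ} (hy : y ≤ 1)
    (h : ∀ x' < x, F x' < y) : x ≤ genInv F y :=
  le_csInf (hF.nonempty hy) fun x' hx' => not_lt.1 fun hlt => (h x' hlt).not_ge hx'.2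

theorem IsCdfLike.le_genInv_of_lt {F : ℝ → ℝ} (hF : IsCdfLike F) {x y : ℝ} (hy : y ≤ 1)
    (h : F x < y) : x ≤ genInv F y :=
  hF.le_genInv hy fun _ hx' => (hF.mono hx'.le).trans_lt h

theorem IsCdfLike.monotoneOn_genInv {F : ℝ → ℝ} (hF : IsCdfLike F) :
    MonotoneOn (genInv F) (Set.Iic 1) := fun a _ _ hb hab =>
  csInf_le_csInf (bddBelow_genInv F a) (hF.nonempty hb) fun _ hx => ⟨hx.1, hab.trans hx.2⟩

theorem norm_exp_I_mul (x : ℝ) : ‖Complex.exp (Complex.I * (x : ℂ))‖ = 1 := by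
  rw [mul_comm, Complex.norm_exp_ofReal_mul_I]

theorem IsCdfLike.aestronglyMeasurable {F : ℝ → ℝ} (hF : IsCdfLike F) :
    AEStronglyMeasurable (fun u => Complex.exp (Complex.I * (genInv F u : ℂ)))
      (volume.restrict (Set.Iic 1)) := by
  have h := aemeasurable_restrict_of_monotoneOn (μ := volume) measurableSet_Iic hF.monotoneOn_genInv
  have hc : Measurable fun x : ℝ => Complex.exp (Complex.I * (x : ℂ)) := by fun_prop
  exact (hc.comp_aemeasurable h).aestronglyMeasurable

theorem IsCdfLike.intervalIntegrable {F : ℝ → ℝ} (hF : IsCdfLike F) {a b : ℝ} (ha : a ≤ 1)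
    (hb : b ≤ 1) :
    IntervalIntegrable (fun u => Complex.exp (Complex.I * (genInv F u : ℂ))) volume a b := by
  rw [intervalIntegrable_iff]
  refine Integrable.mono' (intervalIntegrable_const (c := (1 : ℝ))).def'
    (hF.aestronglyMeasurable.mono_set ?_) (Eventually.of_forall fun x => (norm_exp_I_mul _).le)
  exact fun x hx => hx.2.trans (max_le ha hb)

theorem norm_curveOf_le (F : ℝ → ℝ) {t : ℝ} (ht : t ∈ Set.Icc (0 : ℝ) 1) :
    ‖curveOf F t‖ ≤ 1 := by
  refine (intervalIntegral.norm_integral_le_of_norm_le_const (C := 1)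
    fun x _ => (norm_exp_I_mul _).le).trans ?_
  rw [sub_zero, abs_of_nonneg ht.1, one_mul]
  exact ht.2

/-- Strict inequalities at rational points transfer from `F` to `G n`, and rationals separate
`genInv F u` from any other value. -/
theorem tendsto_genInv {G : ℕ → ℝ → ℝ} {F : ℝ → ℝ} (hF : IsCdfLike F)
    (hG : ∀ᶠ n in atTop, IsCdfLike (G n))
    (hlim : ∀ q : ℚ, Tendsto (fun n => G n q) atTop (𝓝 (F q))) {u : ℝ} (hu : u < 1)
    (hc : ContinuousWithinAt (genInv F) (Set.Iic 1) u) :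
    Tendsto (fun n => genInv (G n) u) atTop (𝓝 (genInv F u)) := by
  have hc' : Tendsto (genInv F) (𝓝 u) (𝓝 (genInv F u)) :=
    hc.continuousAt (Iic_mem_nhds hu)
  refine tendsto_order.2 ⟨fun a ha => ?_, fun b hb => ?_⟩
  · rcases lt_or_ge a 0 with h0 | h0
    · exact Eventually.of_forall fun n => h0.trans_le (genInv_nonneg _ _)
    · obtain ⟨q, haq, hq⟩ := exists_rat_btwn ha
      have hq0 : (0 : ℝ) ≤ q := h0.trans haq.le
      have hlt : F q < u := not_le.1 fun h => (genInv_le hq0 h).not_gt hq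
      filter_upwards [hG, (hlim q).eventually_lt_const hlt] with n h1 h2
      exact haq.trans_le (h1.le_genInv_of_lt hu.le h2)
  -- Continuity at `u` leaves room for a level `u' > u`, so that `u < F q` strictly; `u ≤ F q` would
  -- not pass to `G n`.
  · obtain ⟨u', hu', hul, hu1⟩ : ∃ u', genInv F u' < b ∧ u < u' ∧ u' < 1 := by
      have h1 : ∀ᶠ x in 𝓝[>] u, genInv F x < b :=
        (hc'.mono_left nhdsWithin_le_nhds).eventually_lt_const hb
      obtain ⟨x, hx, hx'⟩ := (h1.and (Ioo_mem_nhdsGT hu)).exists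
      exact ⟨x, hx, hx'.1, hx'.2⟩
    obtain ⟨q, hq, hqb⟩ := exists_rat_btwn hu'
    have hq0 : (0 : ℝ) ≤ q := (genInv_nonneg F u').trans hq.le
    have hge : u' ≤ F q := not_lt.1 fun h => (hF.le_genInv_of_lt hu1.le h).not_gt hq
    filter_upwards [(hlim q).eventually_const_lt (hul.trans_le hge)] with n h2
    exact (genInv_le hq0 h2.le).trans_lt hqb

/-- A monotone `genInv F` has countably many discontinuities, so dominated convergence applies. -/
theorem tendsto_integral_norm_sub {G : ℕ → ℝ → ℝ} {F : ℝ → ℝ} (hF : IsCdfLike F)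
    (hG : ∀ᶠ n in atTop, IsCdfLike (G n))
    (hlim : ∀ q : ℚ, Tendsto (fun n => G n q) atTop (𝓝 (F q))) :
    Tendsto (fun n => ∫ u in (0 : ℝ)..1, ‖Complex.exp (Complex.I * (genInv (G n) u : ℂ)) -
      Complex.exp (Complex.I * (genInv F u : ℂ))‖) atTop (𝓝 0) := by
  have hae : ∀ᵐ u : ℝ, u ≠ 1 ∧ ¬ (u ∈ Set.Iic 1 ∧
      ¬ ContinuousWithinAt (genInv F) (Set.Iic 1) u) := by
    refine (Measure.ae_ne volume 1).and ?_
    exact hF.monotoneOn_genInv.countable_not_continuousWithinAt.ae_notMem volume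
  have key := intervalIntegral.tendsto_integral_filter_of_dominated_convergence
    (a := 0) (b := 1) (μ := volume) (l := atTop) (f := fun _ => (0 : ℝ))
    (F := fun (n : ℕ) (u : ℝ) => ‖Complex.exp (Complex.I * (genInv (G n) u : ℂ)) -
      Complex.exp (Complex.I * (genInv F u : ℂ))‖) (fun _ => 2) ?_ ?_ (by simp) ?_
  · simpa using key
  · filter_upwards [hG] with n hn
    refine ((hn.aestronglyMeasurable.sub hF.aestronglyMeasurable).norm).mono_set ?_
    exact fun x hx => hx.2.trans (by simp)
  · refine Eventually.of_forall fun n => Eventually.of_forall fun u _ => ?_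
    rw [norm_norm]
    refine (norm_sub_le _ _).trans ?_
    rw [norm_exp_I_mul, norm_exp_I_mul]
    norm_num
  · filter_upwards [hae] with u hu hu01
    have hu1 : u ≤ 1 := by simpa using hu01.2
    have hc : ContinuousWithinAt (genInv F) (Set.Iic 1) u := by
      by_contra h
      exact hu.2 ⟨hu1, h⟩
    have h := tendsto_genInv hF hG hlim (lt_of_le_of_ne hu1 hu.1) hc
    have hce : Continuous fun x : ℝ => ‖Complex.exp (Complex.I * (x : ℂ)) -
      Complex.exp (Complex.I * (genInv F u : ℂ))‖ := by fun_prop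
    simpa [Function.comp_def] using (hce.tendsto (genInv F u)).comp h

theorem IsCdfLike.norm_curveOf_sub_le {F G : ℝ → ℝ} (hF : IsCdfLike F) (hG : IsCdfLike G) {t : ℝ}
    (ht : t ∈ Set.Icc (0 : ℝ) 1) :
    ‖curveOf G t - curveOf F t‖ ≤ ∫ u in (0 : ℝ)..1,
      ‖Complex.exp (Complex.I * (genInv G u : ℂ)) - Complex.exp (Complex.I * (genInv F u : ℂ))‖ := by
  rw [curveOf, curveOf, ← intervalIntegral.integral_sub (hG.intervalIntegrable zero_le_one ht.2)
    (hF.intervalIntegrable zero_le_one ht.2)]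
  refine (intervalIntegral.norm_integral_le_integral_norm ht.1).trans ?_
  refine intervalIntegral.integral_mono_interval le_rfl ht.1 ht.2
    (Eventually.of_forall fun _ => norm_nonneg _) ?_
  exact ((hG.intervalIntegrable zero_le_one le_rfl).sub
    (hF.intervalIntegrable zero_le_one le_rfl)).norm

/-! ### The quantile function of a measure on `[0, 2π)` -/

section Quantile

variable {ν : Measure ℝ}

theorem isCdfLike_cdf [IsProbabilityMeasure ν] (hν : ν (Set.Ico 0 (2 * Real.pi))ᶜ = 0) : IsCdfLike (cdf ν) where
  mono _ _ h := measureReal_mono (Set.Icc_subset_Icc_right h)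
  exists_one_le := by
    refine ⟨2 * Real.pi, by positivity, ?_⟩
    have h1 : ν (Set.Ico 0 (2 * Real.pi)) = 1 := (prob_compl_eq_zero_iff measurableSet_Ico).1 hν
    have h2 : ν.real (Set.Ico 0 (2 * Real.pi)) = 1 := by rw [measureReal_def, h1]; rfl
    rw [← h2]
    exact measureReal_mono Set.Ico_subset_Icc_self

theorem measure_Iic_eq (hν : ν (Set.Ico 0 (2 * Real.pi))ᶜ = 0) (x : ℝ) :
    ν (Set.Iic x) = ν (Set.Icc 0 x) := by
  refine le_antisymm ?_ (measure_mono Set.Icc_subset_Iic_self)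
  have : Set.Iic x ⊆ Set.Icc 0 x ∪ (Set.Ico 0 (2 * Real.pi))ᶜ := by
    intro y hy
    rcases le_or_gt 0 y with h | h
    · exact Or.inl ⟨h, hy⟩
    · exact Or.inr fun hy' => h.not_ge hy'.1
  refine (measure_mono this).trans ((measure_union_le _ _).trans ?_)
  rw [hν, add_zero]

/-- Right continuity of the distribution function makes the infimum attained. -/
theorem quantile_le_iff [IsProbabilityMeasure ν] (hν : ν (Set.Ico 0 (2 * Real.pi))ᶜ = 0) {u x : ℝ} (hx : 0 ≤ x)
    (hu : u ≤ 1) : quantile ν u ≤ x ↔ u ≤ cdf ν x := by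
  refine ⟨fun h => ?_, fun h => genInv_le hx h⟩
  have hF := isCdfLike_cdf hν
  have hcdf : cdf ν = ProbabilityTheory.cdf ν := by
    ext y
    rw [ProbabilityTheory.cdf_eq_real, cdf, measureReal_def, measureReal_def, measure_Iic_eq hν]
  have hr : Tendsto (cdf ν) (𝓝[>] x) (𝓝 (cdf ν x)) := by
    rw [hcdf]
    exact ((ProbabilityTheory.cdf ν).right_continuous x).tendsto.mono_left
      (nhdsWithin_mono _ Set.Ioi_subset_Ici_self)
  refine ge_of_tendsto hr ?_
  filter_upwards [self_mem_nhdsWithin] with y hy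
  by_contra! hlt
  obtain ⟨z, hz, hzlt⟩ := exists_lt_of_csInf_lt (hF.nonempty hu) (h.trans_lt hy)
  exact (hz.2.trans (hF.mono hzlt.le)).not_gt hlt

theorem quantile_preimage_Icc [IsProbabilityMeasure ν] (hν : ν (Set.Ico 0 (2 * Real.pi))ᶜ = 0) {x : ℝ} (hx : 0 ≤ x) :
    quantile ν ⁻¹' Set.Icc 0 x ∩ Set.Ioc 0 1 = Set.Ioc 0 (cdf ν x) := by
  ext u
  have h1 : cdf ν x ≤ 1 := measureReal_le_one
  constructor
  · rintro ⟨h, hu⟩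
    exact ⟨hu.1, (quantile_le_iff hν hx hu.2).1 h.2⟩
  · rintro hu
    exact ⟨⟨genInv_nonneg _ _, (quantile_le_iff hν hx (hu.2.trans h1)).2 hu.2⟩, hu.1, hu.2.trans h1⟩

theorem aemeasurable_quantile [IsProbabilityMeasure ν] (hν : ν (Set.Ico 0 (2 * Real.pi))ᶜ = 0) :
    AEMeasurable (quantile ν) (volume.restrict (Set.Ioc 0 1)) :=
  aemeasurable_restrict_of_monotoneOn measurableSet_Ioc
    ((isCdfLike_cdf hν).monotoneOn_genInv.mono fun _ hx => hx.2)

theorem map_quantile [IsProbabilityMeasure ν] (hν : ν (Set.Ico 0 (2 * Real.pi))ᶜ = 0) :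
    (volume.restrict (Set.Ioc 0 1)).map (quantile ν) = ν := by
  have hq := aemeasurable_quantile hν
  have : IsFiniteMeasure ((volume.restrict (Set.Ioc (0 : ℝ) 1)).map (quantile ν)) := inferInstance
  refine Measure.ext_of_Iic _ _ fun x => ?_
  rw [Measure.map_apply_of_aemeasurable hq measurableSet_Iic,
    Measure.restrict_apply₀' measurableSet_Ioc.nullMeasurableSet, measure_Iic_eq hν]
  have e : quantile ν ⁻¹' Set.Iic x = quantile ν ⁻¹' Set.Icc 0 x := by
    ext u
    exact ⟨fun h => ⟨genInv_nonneg _ _, h⟩, fun h => h.2⟩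
  rw [e]
  rcases lt_or_ge x 0 with hx | hx
  · rw [Set.Icc_eq_empty hx.not_ge]
    simp
  · rw [quantile_preimage_Icc hν hx, Real.volume_Ioc, sub_zero, cdf, ofReal_measureReal]

theorem setIntegral_exp_eq_curve [IsProbabilityMeasure ν] (hν : ν (Set.Ico 0 (2 * Real.pi))ᶜ = 0) {θ : ℝ} (hθ : 0 ≤ θ) :
    ∫ t in Set.Icc 0 θ, Complex.exp (Complex.I * (t : ℂ)) ∂ν = curve ν (cdf ν θ) := by
  have hq := aemeasurable_quantile hν
  conv_lhs => rw [← map_quantile hν]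
  have h0 : 0 ≤ cdf ν θ := measureReal_nonneg
  rw [setIntegral_map measurableSet_Icc (by fun_prop) hq, curve,
    intervalIntegral.integral_of_le h0, ← quantile_preimage_Icc hν hθ,
    Measure.restrict_restrict₀' measurableSet_Ioc.nullMeasurableSet]

end Quantile

end ReorderedPolygon

end

noncomputable section

namespace ReorderedPolygon

/-! ### Sorted polygonal lines as unit-speed curves -/

section Polygon

variable {n : ℕ}

theorem sum_filter_lt_succ {M : Type*} [AddCommMonoid M] (f : Fin n → M) (j : Fin n) :
    ∑ i : Fin n with i.val < j.val + 1, f i = ∑ i : Fin n with i.val < j.val, f i + f j := by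
  have : (Finset.univ.filter fun i : Fin n => i.val < j.val + 1) =
      insert j (Finset.univ.filter fun i : Fin n => i.val < j.val) := by
    ext i
    simp only [Finset.mem_filter, Finset.mem_univ, true_and, Finset.mem_insert, Fin.ext_iff]
    omega
  rw [this, Finset.sum_insert (by simp), add_comm]

theorem partialSum_zero (v : Fin n → ℂ) : partialSum v 0 = 0 := by simp [partialSum]

theorem partialSum_succ (v : Fin n → ℂ) (j : Fin n) :
    partialSum v (j.val + 1) = partialSum v j.val + v j := sum_filter_lt_succ v j

/-- The length of the polygonal line up to its `k`-th vertex. -/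
def partialLength (v : Fin n → ℂ) (k : ℕ) : ℝ := ∑ j : Fin n with j.val < k, ‖v j‖

theorem partialLength_zero (v : Fin n → ℂ) : partialLength v 0 = 0 := by simp [partialLength]

theorem partialLength_succ (v : Fin n → ℂ) (j : Fin n) :
    partialLength v (j.val + 1) = partialLength v j.val + ‖v j‖ :=
  sum_filter_lt_succ (fun i => ‖v i‖) j

theorem partialLength_nonneg (v : Fin n → ℂ) (k : ℕ) : 0 ≤ partialLength v k :=
  Finset.sum_nonneg fun _ _ => norm_nonneg _

theorem partialLength_self (v : Fin n → ℂ) : partialLength v n = ∑ j, ‖v j‖ := by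
  rw [partialLength, Finset.filter_true_of_mem fun i _ => i.2]

theorem partialLength_le (v : Fin n → ℂ) (k : ℕ) : partialLength v k ≤ ∑ j, ‖v j‖ :=
  Finset.sum_le_sum_of_subset_of_nonneg (Finset.filter_subset _ _) fun _ _ _ => norm_nonneg _

theorem interpolatedSum_add (v : Fin n → ℂ) (j : Fin n) {s : ℝ} (hs : s ∈ Set.Icc (0 : ℝ) 1) :
    interpolatedSum v (j.val + s) = partialSum v j.val + s * v j := by
  rcases hs.2.lt_or_eq with h | rfl
  · have hfl : ⌊(j.val + s : ℝ)⌋₊ = j.val := by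
      rw [add_comm, Nat.floor_add_natCast hs.1, Nat.floor_eq_zero.2 h, zero_add]
    rw [interpolatedSum, hfl, partialSum_succ]
    push_cast
    ring
  -- At `s = 1` the floor jumps to the next vertex, where the interpolation weight is zero.
  · have hfl : ⌊(j.val + 1 : ℝ)⌋₊ = j.val + 1 := by exact_mod_cast Nat.floor_natCast (j.val + 1)
    rw [interpolatedSum, hfl, partialSum_succ]
    push_cast
    ring

theorem interpolatedSum_natCast (v : Fin n → ℂ) (k : ℕ) :
    interpolatedSum v k = partialSum v k := by
  simp [interpolatedSum]

/-- The proportion of the total length of the `w i` carried by the vectors with argument at most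
`x`. -/
def lengthCdf (w : Fin n → ℂ) (x : ℝ) : ℝ :=
  (∑ i, {z : ℂ | arg z ≤ x}.indicator (fun z => ‖z‖) (w i)) / ∑ i, ‖w i‖

theorem lengthCdf_comp_perm (w : Fin n → ℂ) (σ : Equiv.Perm (Fin n)) :
    lengthCdf (fun j => w (σ j)) = lengthCdf w := by
  ext x
  rw [lengthCdf, lengthCdf, Equiv.sum_comp σ fun i => ‖w i‖,
    Equiv.sum_comp σ fun i => {z : ℂ | arg z ≤ x}.indicator (fun z => ‖z‖) (w i)]

theorem isCdfLike_lengthCdf {w : Fin n → ℂ} (hw : 0 < ∑ i, ‖w i‖) : IsCdfLike (lengthCdf w) where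
  mono a b hab := by
    unfold lengthCdf
    gcongr
  exists_one_le := by
    refine ⟨2 * Real.pi, by positivity, le_of_eq ?_⟩
    rw [lengthCdf, eq_comm, div_eq_one_iff_eq hw.ne']
    refine Finset.sum_congr rfl fun i _ => Set.indicator_of_mem ?_ _
    exact (arg_mem_Ico _).2.le

variable {v : Fin n → ℂ}

/-- By sorting, vectors of argument below `arg (v j)` lie among the first `j`, while the first `j +
1` all have argument at most `arg (v j)`. A zero side gives an empty interval, and ties are
harmless. -/
theorem genInv_lengthCdf (hv : Monotone fun j => arg (v j)) (hL : 0 < ∑ i, ‖v i‖) (j : Fin n)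
    {u : ℝ} (hu : u ∈ Set.Ioc (partialLength v j.val / ∑ i, ‖v i‖)
      (partialLength v (j.val + 1) / ∑ i, ‖v i‖)) :
    genInv (lengthCdf v) u = arg (v j) := by
  have hF := isCdfLike_lengthCdf hL
  have hu1 : u ≤ 1 := hu.2.trans ((div_le_one hL).2 (partialLength_le v _))
  refine le_antisymm (genInv_le (arg_mem_Ico _).1 (hu.2.trans ?_))
    (hF.le_genInv hu1 fun x hx => lt_of_le_of_lt ?_ hu.1)
  · unfold lengthCdf partialLength
    rw [Finset.sum_filter]
    gcongr with i
    split_ifs with h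
    · rw [Set.indicator_of_mem]
      exact hv (Nat.lt_succ_iff.1 h)
    · exact Set.indicator_nonneg (fun _ _ => norm_nonneg _) _
  · unfold lengthCdf partialLength
    rw [Finset.sum_filter]
    gcongr with i
    split_ifs with h
    · exact Set.indicator_le_self' (fun _ _ => norm_nonneg _) _
    · rw [Set.indicator_of_notMem]
      exact fun hi => (hx.trans_le (hv (not_lt.1 h))).not_ge hi

theorem curveOf_lengthCdf_step (hv : Monotone fun j => arg (v j)) (hL : 0 < ∑ i, ‖v i‖)
    (j : Fin n) {s : ℝ} (hs : s ∈ Set.Icc (0 : ℝ) 1) :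
    curveOf (lengthCdf v) ((partialLength v j.val + s * ‖v j‖) / ∑ i, ‖v i‖) =
      curveOf (lengthCdf v) (partialLength v j.val / ∑ i, ‖v i‖) +
        s * v j / ((∑ i, ‖v i‖ : ℝ) : ℂ) := by
  have hF := isCdfLike_lengthCdf hL
  set L := ∑ i, ‖v i‖ with hLdef
  have hs' : s * ‖v j‖ ≤ ‖v j‖ := mul_le_of_le_one_left (norm_nonneg _) hs.2
  have hs0 : 0 ≤ s * ‖v j‖ := mul_nonneg hs.1 (norm_nonneg _)
  have hle2 : (partialLength v j.val + s * ‖v j‖) / L ≤ partialLength v (j.val + 1) / L := by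
    rw [partialLength_succ]
    gcongr
  have h1 (k : ℕ) : partialLength v k / L ≤ 1 := (div_le_one hL).2 (partialLength_le v k)
  have hle1 : partialLength v j.val / L ≤ (partialLength v j.val + s * ‖v j‖) / L := by
    gcongr
    linarith
  rw [curveOf, curveOf, ← intervalIntegral.integral_add_adjacent_intervals
    (hF.intervalIntegrable zero_le_one (h1 j)) (hF.intervalIntegrable (h1 j) (hle2.trans (h1 _)))]
  congr 1
  have hcongr : ∫ u in (partialLength v j.val / L)..((partialLength v j.val + s * ‖v j‖) / L),
      Complex.exp (Complex.I * (genInv (lengthCdf v) u : ℂ)) =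
      ∫ u in (partialLength v j.val / L)..((partialLength v j.val + s * ‖v j‖) / L),
      Complex.exp (Complex.I * (arg (v j) : ℂ)) := by
    refine intervalIntegral.integral_congr_ae (Eventually.of_forall fun u hu => ?_)
    rw [Set.uIoc_of_le hle1] at hu
    rw [genInv_lengthCdf hv hL j ⟨hu.1, hu.2.trans hle2⟩]
  rw [hcongr, intervalIntegral.integral_const, Complex.real_smul]
  conv_rhs => rw [← norm_mul_exp_arg (v j)]
  push_cast
  ring

theorem curveOf_lengthCdf_vertex (hv : Monotone fun j => arg (v j)) (hL : 0 < ∑ i, ‖v i‖)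
    {k : ℕ} (hk : k ≤ n) :
    curveOf (lengthCdf v) (partialLength v k / ∑ i, ‖v i‖) =
      partialSum v k / ((∑ i, ‖v i‖ : ℝ) : ℂ) := by
  induction k with
  | zero => simp [partialLength_zero, partialSum_zero, curveOf]
  | succ k ih =>
    have h := curveOf_lengthCdf_step hv hL ⟨k, hk⟩ (s := 1) ⟨zero_le_one, le_rfl⟩
    have e1 := partialLength_succ v ⟨k, hk⟩
    have e2 := partialSum_succ v ⟨k, hk⟩
    simp only at h e1 e2
    rw [e1, e2, add_div (partialSum v k), ← ih (by omega)]
    simpa using h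

theorem curveOf_lengthCdf_edge (hv : Monotone fun j => arg (v j)) (hL : 0 < ∑ i, ‖v i‖)
    (j : Fin n) {s : ℝ} (hs : s ∈ Set.Icc (0 : ℝ) 1) :
    curveOf (lengthCdf v) ((partialLength v j.val + s * ‖v j‖) / ∑ i, ‖v i‖) =
      interpolatedSum v (j.val + s) / ((∑ i, ‖v i‖ : ℝ) : ℂ) := by
  rw [curveOf_lengthCdf_step hv hL j hs, curveOf_lengthCdf_vertex hv hL j.2.le,
    interpolatedSum_add v j hs, add_div]

theorem polygonalLine_eq_image_curveOf (hv : Monotone fun j => arg (v j))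
    (hL : 0 < ∑ i, ‖v i‖) :
    polygonalLine v =
      (fun t => ((∑ i, ‖v i‖ : ℝ) : ℂ) * curveOf (lengthCdf v) t) '' Set.Icc (0 : ℝ) 1 := by
  have hLC : ((∑ i, ‖v i‖ : ℝ) : ℂ) ≠ 0 := by exact_mod_cast hL.ne'
  have hmem (j : Fin n) {s : ℝ} (hs : s ∈ Set.Icc (0 : ℝ) 1) :
      (partialLength v j.val + s * ‖v j‖) / ∑ i, ‖v i‖ ∈ Set.Icc (0 : ℝ) 1 := by
    refine ⟨div_nonneg (add_nonneg (partialLength_nonneg v _)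
      (mul_nonneg hs.1 (norm_nonneg _))) hL.le, (div_le_one hL).2 ?_⟩
    refine le_trans ?_ (partialLength_le v (j.val + 1))
    rw [partialLength_succ]
    gcongr
    exact mul_le_of_le_one_left (norm_nonneg _) hs.2
  apply Set.Subset.antisymm
  · rintro _ ⟨t, ht, rfl⟩
    rcases ht.2.lt_or_eq with h | rfl
    · have hfl : ⌊t⌋₊ < n := (Nat.floor_lt ht.1).2 h
      have hs : t - ⌊t⌋₊ ∈ Set.Icc (0 : ℝ) 1 :=
        ⟨sub_nonneg.2 (Nat.floor_le ht.1), by linarith [Nat.lt_floor_add_one t]⟩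
      refine ⟨_, hmem ⟨⌊t⌋₊, hfl⟩ hs, ?_⟩
      simp only
      rw [curveOf_lengthCdf_edge hv hL ⟨⌊t⌋₊, hfl⟩ hs, mul_div_cancel₀ _ hLC]
      simp
    · refine ⟨1, ⟨zero_le_one, le_rfl⟩, ?_⟩
      have h := curveOf_lengthCdf_vertex hv hL le_rfl
      rw [partialLength_self, div_self hL.ne'] at h
      simp only
      rw [h, mul_div_cancel₀ _ hLC, interpolatedSum_natCast]
  · rintro _ ⟨u, hu, rfl⟩
    -- The first vertex at arc length at least `u` times the total ends the side containing the
    -- point; by minimality that side has positive length.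
    have hex : ∃ k, u * ∑ i, ‖v i‖ ≤ partialLength v k :=
      ⟨n, by rw [partialLength_self]; exact mul_le_of_le_one_left hL.le hu.2⟩
    have hfind := Nat.find_spec hex
    have hmin := fun k => Nat.find_min (m := k) hex
    have hle : Nat.find hex ≤ n :=
      Nat.find_min' hex (by rw [partialLength_self]; exact mul_le_of_le_one_left hL.le hu.2)
    generalize Nat.find hex = k at hfind hmin hle
    rcases k with _ | j
    · rw [partialLength_zero] at hfind
      have hu0 : u = 0 := le_antisymm (not_lt.1 fun h => hfind.not_gt (mul_pos h hL)) hu.1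
      refine ⟨0, ⟨le_rfl, n.cast_nonneg⟩, ?_⟩
      have := interpolatedSum_natCast v 0
      rw [partialSum_zero] at this
      rw [hu0]
      simpa [curveOf] using this
    · have hj := not_le.1 (hmin j (Nat.lt_succ_self j))
      have e1 := partialLength_succ v ⟨j, hle⟩
      simp only at e1
      rw [e1] at hfind
      have hpos : 0 < ‖v ⟨j, hle⟩‖ := by linarith
      set s := (u * ∑ i, ‖v i‖ - partialLength v j) / ‖v ⟨j, hle⟩‖ with hs_def
      have hs : s ∈ Set.Icc (0 : ℝ) 1 :=
        ⟨div_nonneg (by linarith) hpos.le, (div_le_one hpos).2 (by linarith)⟩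
      have h := curveOf_lengthCdf_edge hv hL ⟨j, hle⟩ hs
      have e2 : (partialLength v j + s * ‖v ⟨j, hle⟩‖) / ∑ i, ‖v i‖ = u := by
        rw [hs_def, div_mul_cancel₀ _ hpos.ne', add_sub_cancel, mul_div_cancel_right₀ _ hL.ne']
      simp only at h
      rw [e2] at h
      refine ⟨j + s, ⟨add_nonneg j.cast_nonneg hs.1, ?_⟩, ?_⟩
      · have : (j : ℝ) + 1 ≤ n := by exact_mod_cast hle
        linarith [hs.2]
      · simp only
        rw [h, mul_div_cancel₀ _ hLC]

/-! ### The vertex `S(N_n(θ))`. -/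

theorem lt_card_iff_of_isLowerSet {T : Finset (Fin n)} (hT : IsLowerSet (T : Set (Fin n)))
    (j : Fin n) : j.val < T.card ↔ j ∈ T := by
  constructor
  · intro h
    by_contra hj
    have hsub : T ⊆ Finset.Iio j := fun i hi =>
      Finset.mem_Iio.2 (not_le.1 fun hji => hj (hT hji hi))
    have := Finset.card_le_card hsub
    rw [Fin.card_Iio] at this
    omega
  · intro h
    have hsub : Finset.Iic j ⊆ T := fun i hi => hT (Finset.mem_Iic.1 hi) h
    have := Finset.card_le_card hsub
    rw [Fin.card_Iic] at this
    omega

/-- After sorting, the positions with argument at most `θ` form an initial segment, determined by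
its cardinality. -/
theorem partialSum_countArgLE {w : Fin n → ℂ} {σ : Equiv.Perm (Fin n)} (hσ : SortsByArg w σ)
    (θ : ℝ) :
    partialSum (fun j => w (σ j)) (countArgLE w θ) =
      ∑ i, {z : ℂ | arg z ≤ θ}.indicator (fun z => z) (w i) := by
  classical
  set T := Finset.univ.filter fun j => arg (w (σ j)) ≤ θ with hT_def
  have hT : IsLowerSet (T : Set (Fin n)) := by
    intro a b hba ha
    simp only [hT_def, Finset.coe_filter, Finset.mem_univ, true_and, Set.mem_ofPred_eq] at ha ⊢
    exact (hσ hba).trans ha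
  have hcard : countArgLE w θ = T.card := by
    rw [countArgLE, Nat.card_eq_fintype_card, Fintype.card_subtype]
    refine (Finset.card_equiv σ fun i => ?_).symm
    simp [hT_def]
  rw [← Equiv.sum_comp σ, partialSum, hcard, Finset.sum_filter]
  refine Finset.sum_congr rfl fun j _ => ?_
  simp only [lt_card_iff_of_isLowerSet hT]
  simp [hT_def, Set.indicator_apply]

end Polygon

end ReorderedPolygon

end

namespace ReorderedPolygon

/-! ### Hausdorff convergence of the polygonal lines -/

theorem tendsto_hausdorffEDist_polygonalLine {μ : Measure ℂ} [IsProbabilityMeasure μ]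
    (hμ_int : Integrable (fun z : ℂ => z) μ) (hE : 0 < meanNorm μ)
    (w : (n : ℕ) → Fin n → ℂ) (σ : (n : ℕ) → Equiv.Perm (Fin n))
    (hσ : ∀ n, SortsByArg (w n) (σ n))
    (hL : Tendsto (fun n : ℕ => (n : ℝ)⁻¹ • ∑ i, ‖w n i‖) atTop (𝓝 (meanNorm μ)))
    (hq : ∀ q : ℚ, Tendsto (fun n : ℕ => (n : ℝ)⁻¹ •
      ∑ i, {z : ℂ | arg z ≤ q}.indicator (fun z => ‖z‖) (w n i)) atTop
      (𝓝 (∫ z, {z : ℂ | arg z ≤ q}.indicator (fun z => ‖z‖) z ∂μ))) :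
    Tendsto (fun n : ℕ => Metric.hausdorffEDist
        ((fun z : ℂ => z / ((n * meanNorm μ : ℝ) : ℂ)) '' polygonalLine fun j => w n (σ n j))
        (curveSet (K μ))) atTop (𝓝 0) := by
  have hprob := isProbabilityMeasure_K hμ_int hE
  have hF : IsCdfLike (cdf (K μ)) := isCdfLike_cdf (K_compl_Ico hμ_int)
  have hpos : ∀ᶠ n : ℕ in atTop, 0 < n ∧ 0 < ∑ i, ‖w n i‖ := by
    filter_upwards [eventually_gt_atTop 0, hL.eventually_const_lt hE] with n hn h
    exact ⟨hn, pos_of_mul_pos_right h (by positivity)⟩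
  have hG : ∀ᶠ n : ℕ in atTop, IsCdfLike (lengthCdf (w n)) :=
    hpos.mono fun n hn => isCdfLike_lengthCdf hn.2
  have hlim (q : ℚ) : Tendsto (fun n => lengthCdf (w n) q) atTop (𝓝 (cdf (K μ) q)) := by
    rw [cdf_K hμ_int hE]
    refine ((hq q).div hL hE.ne').congr' ?_
    filter_upwards [hpos] with n hn
    have : (n : ℝ) ≠ 0 := by exact_mod_cast hn.1.ne'
    simp only [smul_eq_mul, Pi.div_apply, lengthCdf]
    rw [mul_div_mul_left _ _ (inv_ne_zero this)]
  have hδ := tendsto_integral_norm_sub hF hG hlim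
  set δ := fun n => ∫ u in (0 : ℝ)..1, ‖Complex.exp (Complex.I * (genInv (lengthCdf (w n)) u : ℂ)) -
      Complex.exp (Complex.I * (genInv (cdf (K μ)) u : ℂ))‖ with hδ_def
  have hc : Tendsto (fun n : ℕ => |(∑ i, ‖w n i‖) / (n * meanNorm μ) - 1|) atTop (𝓝 0) := by
    have h := ((hL.div_const (meanNorm μ)).sub_const 1).abs
    rw [div_self hE.ne', sub_self, abs_zero] at h
    refine h.congr fun n => ?_
    rw [smul_eq_mul, inv_mul_eq_div, div_div]
  have hsum := ENNReal.tendsto_ofReal (hc.add hδ)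
  rw [add_zero, ENNReal.ofReal_zero] at hsum
  refine tendsto_of_tendsto_of_tendsto_of_le_of_le' tendsto_const_nhds hsum
    (Eventually.of_forall fun _ => zero_le) ?_
  filter_upwards [hpos, hG] with n hn hGn
  have hsumeq : ∑ j, ‖w n (σ n j)‖ = ∑ i, ‖w n i‖ := Equiv.sum_comp (σ n) fun i => ‖w n i‖
  have hpoly := polygonalLine_eq_image_curveOf (hσ n) (by rw [hsumeq]; exact hn.2)
  rw [hsumeq, lengthCdf_comp_perm] at hpoly
  have hdist {t : ℝ} (ht : t ∈ Set.Icc (0 : ℝ) 1) :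
      edist (((∑ i, ‖w n i‖ : ℝ) : ℂ) * curveOf (lengthCdf (w n)) t /
        ((n * meanNorm μ : ℝ) : ℂ)) (curve (K μ) t) ≤
      ENNReal.ofReal (|(∑ i, ‖w n i‖) / (n * meanNorm μ) - 1| + δ n) := by
    rw [edist_dist, dist_eq_norm]
    refine ENNReal.ofReal_le_ofReal ?_
    -- Points with the same parameter `t` are compared: one error comes from the scale, the other
    -- from the tangents.
    have e : ((∑ i, ‖w n i‖ : ℝ) : ℂ) * curveOf (lengthCdf (w n)) t /
        ((n * meanNorm μ : ℝ) : ℂ) - curve (K μ) t =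
        (((∑ i, ‖w n i‖) / (n * meanNorm μ) - 1 : ℝ) : ℂ) * curveOf (lengthCdf (w n)) t +
        (curveOf (lengthCdf (w n)) t - curve (K μ) t) := by
      push_cast
      ring
    rw [e]
    refine (norm_add_le _ _).trans (add_le_add ?_ (hF.norm_curveOf_sub_le hGn ht))
    rw [norm_mul, Complex.norm_real, Real.norm_eq_abs]
    exact mul_le_of_le_one_right (abs_nonneg _) (norm_curveOf_le _ ht)
  rw [hpoly]
  refine Metric.hausdorffEDist_le_of_mem_edist ?_ ?_
  · rintro _ ⟨_, ⟨t, ht, rfl⟩, rfl⟩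
    exact ⟨_, ⟨t, ht, rfl⟩, hdist ht⟩
  · rintro _ ⟨t, ht, rfl⟩
    exact ⟨_, ⟨_, ⟨t, ht, rfl⟩, rfl⟩, by rw [edist_comm]; exact hdist ht⟩

end ReorderedPolygon

theorem mainTheorem9 {Ω : Type*} [MeasurableSpace Ω] (P : Measure Ω) [IsProbabilityMeasure P]
    (X : ℕ → Ω → ℂ) (hX_meas : ∀ i, Measurable (X i)) (hX_indep : iIndepFun X P)
    (hX_ident : ∀ i, IdentDistrib (X i) (X 0) P P)
    (μ : Measure ℂ) [IsProbabilityMeasure μ]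
    (hμ_law : P.map (fun ω => X 1 ω - X 0 ω) = μ)
    (hμ_int : Integrable (fun z : ℂ => z) μ) (hμ_ne : μ ≠ Measure.dirac 0)
    (σ : (n : ℕ) → Ω → Equiv.Perm (Fin n))
    (hσ : ∀ n ω, ReorderedPolygon.SortsByArg
      (ReorderedPolygon.cyclicIncrement (fun i => X i ω) n) (σ n ω)) :
    (∀ᵐ ω ∂P, Tendsto
      (fun n : ℕ => Metric.hausdorffEDist
        ((fun z : ℂ => z / ((n * ReorderedPolygon.meanNorm μ : ℝ) : ℂ)) ''
          ReorderedPolygon.polygonalLine (fun j =>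
            ReorderedPolygon.cyclicIncrement (fun i => X i ω) n (σ n ω j)))
        (ReorderedPolygon.curveSet (ReorderedPolygon.K μ)))
      atTop (𝓝 0)) ∧
    ∀ θ ∈ Set.Ico 0 (2 * Real.pi),
      (∀ᵐ ω ∂P, Tendsto
        (fun n : ℕ =>
          ReorderedPolygon.partialSum
              (fun j => ReorderedPolygon.cyclicIncrement (fun i => X i ω) n (σ n ω j))
              (ReorderedPolygon.countArgLE
                (ReorderedPolygon.cyclicIncrement (fun i => X i ω) n) θ) /
            ((n * ReorderedPolygon.meanNorm μ : ℝ) : ℂ))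
        atTop
        (𝓝 (∫ t in Set.Icc 0 θ, Complex.exp (Complex.I * (t : ℂ))
          ∂(ReorderedPolygon.K μ)))) ∧
      ∫ t in Set.Icc 0 θ, Complex.exp (Complex.I * (t : ℂ)) ∂(ReorderedPolygon.K μ) =
        ReorderedPolygon.curve (ReorderedPolygon.K μ)
          (ReorderedPolygon.cdf (ReorderedPolygon.K μ) θ) := by
  subst hμ_law
  have hE := ReorderedPolygon.meanNorm_pos _ hμ_int hμ_ne
  refine ⟨?_, fun θ hθ => ⟨?_, ?_⟩⟩
  · filter_upwards [ReorderedPolygon.ae_tendsto_mean_cyclicIncrement hX_meas hX_indep hX_ident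
        hμ_int (f := fun z => ‖z‖) measurable_norm.stronglyMeasurable (fun z => (norm_norm z).le),
      -- Rational thresholds keep the exceptional null sets countable in number.
      ae_all_iff.2 fun q : ℚ => ReorderedPolygon.ae_tendsto_mean_cyclicIncrement hX_meas hX_indep
        hX_ident hμ_int
        (measurable_norm.stronglyMeasurable.indicator (ReorderedPolygon.measurableSet_arg_le q))
        (fun z => (norm_indicator_le_norm_self _ z).trans (norm_norm z).le)] with ω h1 h2
    exact ReorderedPolygon.tendsto_hausdorffEDist_polygonalLine hμ_int hE _ _
      (fun n => hσ n ω) h1 h2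
  · filter_upwards [ReorderedPolygon.ae_tendsto_mean_cyclicIncrement hX_meas hX_indep hX_ident
      hμ_int (measurable_id.stronglyMeasurable.indicator
        (ReorderedPolygon.measurableSet_arg_le θ))
        (fun z => norm_indicator_le_norm_self _ z)] with ω h
    rw [ReorderedPolygon.setIntegral_exp_K hμ_int hE]
    refine (h.div_const _).congr fun n => ?_
    rw [ReorderedPolygon.partialSum_countArgLE (hσ n ω), Complex.real_smul]
    push_cast
    rw [inv_mul_eq_div, div_div]
    rfl
  · have := ReorderedPolygon.isProbabilityMeasure_K hμ_int hE
    exact ReorderedPolygon.setIntegral_exp_eq_curve (ReorderedPolygon.K_compl_Ico hμ_int) hθ.1
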